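/- Let \[ \begin{aligned} f(x,y,z,w) = {} & 4w^4x^2+56w^4xz+200w^4z^2-504w^3x^2z-3696w^3xz^2-112w^2x^4-656w^2x^3z\\ & -12w^2x^2y^2+168w^2x^2yz+20008w^2x^2z^2-88w^2xy^2z+2352w^2xyz^2+11200w^2xz^3\\ & +8400w^2yz^3+20000w^2z^4+16wx^4y+7896wx^4z+128wx^3yz-10752wx^3z^2\\ & +840wx^2y^2z-10328wx^2yz^2-76944wx^2z^3-77616wxyz^3-184800wxz^4\\ & +932x^6-1656x^5z+188x^4y^2-2352x^4yz-10020x^4z^2-256x^3y^2z-13776x^3yz^2\\ & +3520x^3z^3+10x^2y^4-252x^2y^3z-68x^2y^2z^2+49728x^2yz^3+175824x^2z^4\\ & -1848xy^3z^2+20296xy^2z^3+235200xyz^4+420000xz^5+88200y^2z^4+420000yz^5+500000z^6 , \end{aligned} \] a polynomial in $\mathbb{Q}[x,y,z,w]$. Then $f$ is homogeneous of degree $6$, and: 1. for every $\alpha\in\mathbb{C}$ with $\alpha^3=2$, the field $\mathbb{Q}(\alpha)$ has degree $3$ over $\mathbb{Q}$, and $f=p_1^2+p_2^2+p_3^2$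 for some $p_1,p_2,p_3\in\mathbb{Q}(\alpha)[x,y,z,w]$; 2. $f$ is not a sum of squares of polynomials in $\mathbb{Q}[x,y,z,w]$; 3. $f$ is irreducible over $\mathbb{C}$, that is, irreducible in $\mathbb{C}[x,y,z,w]$. In particular, two questions of Scheiderer are answered. It is not true that, for every number field $K$ of odd degree over $\mathbb{Q}$, every form (homogeneous polynomial) over $\mathbb{Q}$ that is a sum of squares of polynomials over $K$ is a sum of squares of polynomials over $\mathbb{Q}$. And there are forms in $\mathbb{Q}[x_1,\dots,x_n]$, for some $n$, that are sums of squares of polynomials over $\mathbb{R}$ but not over $\mathbb{Q}$ and that are irreducible over $\mathbb{C}$. -/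

import Mathlib

/-- The explicit quaternary sextic expression, evaluated at four elements
`x, y, z, w` of a commutative ring. -/
def sexticExpr {R : Type*} [CommRing R] (x y z w : R) : R :=
  4*w^4*x^2 + 56*w^4*x*z + 200*w^4*z^2 - 504*w^3*x^2*z - 3696*w^3*x*z^2
  - 112*w^2*x^4 - 656*w^2*x^3*z - 12*w^2*x^2*y^2 + 168*w^2*x^2*y*z + 20008*w^2*x^2*z^2
  - 88*w^2*x*y^2*z + 2352*w^2*x*y*z^2 + 11200*w^2*x*z^3
  + 8400*w^2*y*z^3 + 20000*w^2*z^4 + 16*w*x^4*y + 7896*w*x^4*z + 128*w*x^3*y*z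
  - 10752*w*x^3*z^2
  + 840*w*x^2*y^2*z - 10328*w*x^2*y*z^2 - 76944*w*x^2*z^3
  - 77616*w*x*y*z^3 - 184800*w*x*z^4 + 932*x^6 - 1656*x^5*z + 188*x^4*y^2 - 2352*x^4*y*z
  - 10020*x^4*z^2
  - 256*x^3*y^2*z - 13776*x^3*y*z^2 + 3520*x^3*z^3 + 10*x^2*y^4 - 252*x^2*y^3*z
  - 68*x^2*y^2*z^2
  + 49728*x^2*y*z^3 + 175824*x^2*z^4 - 1848*x*y^3*z^2 + 20296*x*y^2*z^3
  + 235200*x*y*z^4 + 420000*x*z^5 + 88200*y^2*z^4 + 420000*y*z^5 + 500000*z^6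

/-- The form `f ∈ ℚ[x, y, z, w]`, with `x, y, z, w` the variables `X 0, X 1, X 2, X 3`. -/
noncomputable def sexticForm : MvPolynomial (Fin 4) ℚ :=
  sexticExpr (MvPolynomial.X 0) (MvPolynomial.X 1) (MvPolynomial.X 2) (MvPolynomial.X 3)

/-! The decomposition over a ring containing a cube root `t` of 2 is an explicit identity
(`sexticExpr_eq_sum_sq`).

Over ℚ, a sum of squares representing the form may be taken to consist of cubics
(`exists_isHomogeneous_of_isSumSq`). On each of the planes x = 0 and x + 4z = 0 the form is a
constant times the square of z times a conic, so every cubic vanishes on these curves and lies in a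
six-dimensional space (`conicCubic`). Comparing coefficients leaves the relevant Gram matrix entries
depending only on B = b·b and D = d·d (`gram_relations`). Positive semidefiniteness then gives three
inequalities whose only solution has (D/8)³ = 2 (`cube_eq_two_of_inequalities`), which is impossible
in ℚ.

Over ℂ, with s² = -1, the form is (p₁ + s p₂)(p₁ - s p₂) + p₃². In the grading by degree in y, w its
top part is a product of two non-associated irreducibles, `topPart s` and `topPart (-s)`. A
factorization that splits them must agree with p₁ ± s p₂ in degree one, and the remainder p₃² then
gives a contradiction (`map_sexticForm_ne_mul_of_leadingCoeff`). In any other factorization one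
factor has constant leading part, and is a unit. -/

/-! ### Coefficients of a product of two quadratics plus a square -/

section Quartic

variable {S : Type*} [CommRing S] (a₂ a₁ a₀ b₂ b₁ b₀ r₁ r₀ : S)

open Polynomial in
theorem quadratic_mul_add_sq_eq :
    (C a₂ * X ^ 2 + C a₁ * X + C a₀) * (C b₂ * X ^ 2 + C b₁ * X + C b₀) + (C r₁ * X + C r₀) ^ 2 =
      C (a₂*b₂) * X ^ 4 + C (a₂*b₁ + a₁*b₂) * X ^ 3 + C (a₂*b₀ + a₁*b₁ + a₀*b₂ + r₁^2) * X ^ 2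
        + C (a₁*b₀ + a₀*b₁ + 2*r₁*r₀) * X + C (a₀*b₀ + r₀^2) := by
  simp only [map_add, map_mul, map_pow, map_ofNat]
  ring

open Polynomial in
theorem coeff_quadratic_mul_add_sq_three :
    ((C a₂ * X ^ 2 + C a₁ * X + C a₀) * (C b₂ * X ^ 2 + C b₁ * X + C b₀)
      + (C r₁ * X + C r₀) ^ 2).coeff 3 = a₂*b₁ + a₁*b₂ := by
  rw [quadratic_mul_add_sq_eq]
  simp only [coeff_add, coeff_C_mul, coeff_X_pow, coeff_X, coeff_C]
  norm_num

open Polynomial in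
theorem coeff_quadratic_mul_add_sq_two :
    ((C a₂ * X ^ 2 + C a₁ * X + C a₀) * (C b₂ * X ^ 2 + C b₁ * X + C b₀)
      + (C r₁ * X + C r₀) ^ 2).coeff 2 = a₂*b₀ + a₁*b₁ + a₀*b₂ + r₁^2 := by
  rw [quadratic_mul_add_sq_eq]
  simp only [coeff_add, coeff_C_mul, coeff_X_pow, coeff_X, coeff_C]
  norm_num

open Polynomial in
theorem leadingCoeff_quadratic_mul_add_sq (h : a₂*b₂ ≠ 0) :
    ((C a₂ * X ^ 2 + C a₁ * X + C a₀) * (C b₂ * X ^ 2 + C b₁ * X + C b₀)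
      + (C r₁ * X + C r₀) ^ 2).leadingCoeff = a₂*b₂ := by
  have hd : (C (a₂*b₂) * X ^ 4 + C (a₂*b₁ + a₁*b₂) * X ^ 3
      + C (a₂*b₀ + a₁*b₁ + a₀*b₂ + r₁^2) * X ^ 2
      + C (a₁*b₀ + a₀*b₁ + 2*r₁*r₀) * X + C (a₀*b₀ + r₀^2)).natDegree = 4 := by
    compute_degree!
  rw [quadratic_mul_add_sq_eq, leadingCoeff, hd]
  simp only [coeff_add, coeff_C_mul, coeff_X_pow, coeff_X, coeff_C]
  norm_num

end Quartic

/-! ### Three squares over a ring containing a cube root of 2 -/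

open MvPolynomial

/-- The first cubic in the decomposition of the sextic over a ring containing a cube root of `2`. -/
def cubicFst {R : Type*} [CommRing R] (t x y z w : R) : R :=
  2*x*w^2 - 3*x*y^2 + 14*z*w^2 - 126*x*z*w + 42*x*y*z + 294*y*z^2
  + (296 - 8*t^2)*x*z^2 + (42 - 8*t - 2*t^2)*x^2*z - (28 + 2*t)*x^3 + 700*z^3

/-- The second cubic in the decomposition of the sextic. -/
def cubicSnd {R : Type*} [CommRing R] (t x y z w : R) : R :=
  -x*y^2 + 2*z*w^2 - 42*x*z*w + 42*y*z^2 + (28 + 56*t^2)*x*z^2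
  + (2 + 24*t + 22*t^2)*x^2*z + (2*t^2 + 6*t - 10)*x^3 + 100*z^3

/-- The third cubic in the decomposition of the sextic. -/
def cubicTrd {R : Type*} [CommRing R] (t x y z w : R) : R :=
  2*x*(x + 4*z)*(t^2*w + t*y + 21*z)

theorem sexticExpr_eq_sum_sq {R : Type*} [CommRing R] {t : R} (ht : t^3 = 2) (x y z w : R) :
    sexticExpr x y z w =
      cubicFst t x y z w ^ 2 + cubicSnd t x y z w ^ 2 + cubicTrd t x y z w ^ 2 := by
  simp only [sexticExpr, cubicFst, cubicSnd, cubicTrd]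
  -- The cofactor is minus the quotient of (sum of squares - form), as a polynomial in `t`, by `t^3
  -- - 2`.
  linear_combination (-(4*x^6*t + 24*x^6 + 88*x^5*z*t + 368*x^5*z + 8*x^4*y*w + 712*x^4*z^2*t
    + 1792*x^4*z^2 + 4*x^4*w^2*t + 64*x^3*y*z*w + 2496*x^3*z^3*t + 2816*x^3*z^3
    + 32*x^3*z*w^2*t + 128*x^2*y*z^2*w + 3200*x^2*z^4*t + 64*x^2*z^2*w^2*t)) * ht

theorem map_sexticForm {R : Type*} [CommRing R] [Algebra ℚ R] :
    MvPolynomial.map (algebraMap ℚ R) sexticForm = sexticExpr (X 0) (X 1) (X 2) (X 3) := by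
  simp [sexticForm, sexticExpr]

theorem eval_sexticForm (v : Fin 4 → ℚ) :
    eval v sexticForm = sexticExpr (v 0) (v 1) (v 2) (v 3) := by
  simp [sexticForm, sexticExpr]

theorem map_sexticForm_eq_sum_sq {R : Type*} [CommRing R] [Algebra ℚ R] {t : R} (ht : t^3 = 2) :
    ∃ p : Fin 3 → MvPolynomial (Fin 4) R,
      MvPolynomial.map (algebraMap ℚ R) sexticForm = ∑ i, p i ^ 2 := by
  refine ⟨![cubicFst (C t) (X 0) (X 1) (X 2) (X 3), cubicSnd (C t) (X 0) (X 1) (X 2) (X 3),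
    cubicTrd (C t) (X 0) (X 1) (X 2) (X 3)], ?_⟩
  rw [map_sexticForm, sexticExpr_eq_sum_sq (t := C t) (by rw [← map_pow, ht, map_ofNat])]
  simp [Fin.sum_univ_three]

/-! ### The cubic field -/

theorem cube_ne_two (b : ℚ) : b ^ 3 ≠ 2 := by
  intro h
  have := (irrational_nrt_of_notint_nrt 3 (2:ℤ) (x := (b:ℝ))
    (by exact_mod_cast h) ?_ (by norm_num))
  · exact this ⟨b, rfl⟩
  · rintro ⟨y, hy⟩
    have h2 : y ^ 3 = 2 := by
      have : b = y := by exact_mod_cast hy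
      rw [this] at h; exact_mod_cast h
    have h1 : y < 2 := by nlinarith [sq_nonneg y, sq_nonneg (y+1)]
    have h0 : 0 < y := by by_contra hc; nlinarith [sq_nonneg y, sq_nonneg (y+1)]
    interval_cases y; omega

theorem irreducible_X_pow_three_sub_two : Irreducible (Polynomial.X ^ 3 - Polynomial.C (2 : ℚ)) :=
  X_pow_sub_C_irreducible_of_prime Nat.prime_three cube_ne_two

theorem minpoly_of_cube_eq_two {α : ℂ} (h : α ^ 3 = 2) :
    minpoly ℚ α = Polynomial.X ^ 3 - Polynomial.C 2 :=
  (minpoly.eq_of_irreducible_of_monic irreducible_X_pow_three_sub_two (by simp [h])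
    (Polynomial.monic_X_pow_sub_C _ (by norm_num))).symm

theorem finrank_adjoin_of_cube_eq_two {α : ℂ} (h : α ^ 3 = 2) :
    Module.finrank ℚ (IntermediateField.adjoin ℚ {α}) = 3 := by
  have hi : IsIntegral ℚ α := ⟨Polynomial.X ^ 3 - Polynomial.C 2,
    Polynomial.monic_X_pow_sub_C _ (by norm_num), by simp [h]⟩
  rw [IntermediateField.adjoin.finrank hi, minpoly_of_cube_eq_two h,
    Polynomial.natDegree_X_pow_sub_C]

/-! ### Sums of squares of forms -/

/-- Restriction of a polynomial to the line through the origin spanned by `v`. -/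
noncomputable def restrictLine {σ : Type*} (v : σ → ℚ) : MvPolynomial σ ℚ →ₐ[ℚ] Polynomial ℚ :=
  aeval fun i => Polynomial.C (v i) * Polynomial.X

theorem restrictLine_monomial {σ : Type*} (v : σ → ℚ) (d : σ →₀ ℕ) (a : ℚ) :
    restrictLine v (monomial d a) =
      Polynomial.C (eval v (monomial d a)) * Polynomial.X ^ d.degree := by
  simp only [restrictLine, aeval_monomial, eval_monomial, mul_pow, Finsupp.prod_mul,
    map_mul, Polynomial.algebraMap_eq, mul_assoc]
  congr 2
  · simp [Finsupp.prod]
  · simp [Finsupp.prod, Finsupp.degree_apply, Finset.prod_pow_eq_pow_sum]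

/-- Turns statements about homogeneous components into statements about univariate coefficients,
where degrees of sums of squares are easy to control. -/
theorem coeff_restrictLine {σ : Type*} (v : σ → ℚ) (p : MvPolynomial σ ℚ) (k : ℕ) :
    (restrictLine v p).coeff k = eval v (homogeneousComponent k p) := by
  induction p using MvPolynomial.induction_on' with
  | monomial d a =>
    rw [restrictLine_monomial, Polynomial.coeff_C_mul, Polynomial.coeff_X_pow,
      homogeneousComponent_of_mem (isHomogeneous_monomial a rfl)]
    split_ifs <;> simp
  | add p q hp hq => simp [hp, hq]

theorem isHomogeneous_of_restrictLine {σ : Type*} {p : MvPolynomial σ ℚ} {n : ℕ}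
    (h : ∀ v, restrictLine v p = Polynomial.C (eval v p) * Polynomial.X ^ n) :
    p.IsHomogeneous n := by
  have : homogeneousComponent n p = p := MvPolynomial.funext fun v => by
    rw [← coeff_restrictLine, h]; simp
  rw [← this]
  exact homogeneousComponent_isHomogeneous n p

theorem restrictLine_sexticForm (v : Fin 4 → ℚ) :
    restrictLine v sexticForm = Polynomial.C (eval v sexticForm) * Polynomial.X ^ 6 := by
  rw [eval_sexticForm]
  simp only [sexticForm, sexticExpr, restrictLine, map_add, map_sub, map_mul, map_pow,
    map_ofNat, aeval_X]
  ring

theorem sexticForm_isHomogeneous : sexticForm.IsHomogeneous 6 :=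
  isHomogeneous_of_restrictLine restrictLine_sexticForm

theorem IsSumSq.exists_fin_sum {R : Type*} [CommRing R] {g : R} (h : IsSumSq g) :
    ∃ (m : ℕ) (p : Fin m → R), g = ∑ i, p i * p i := by
  induction h with
  | zero => exact ⟨0, 0, by simp⟩
  | sq_add a _ ih =>
    obtain ⟨m, p, rfl⟩ := ih
    exact ⟨m + 1, Fin.cons a p, by simp [Fin.sum_univ_succ]⟩

/-- No cancellation of leading terms occurs in a sum of squares over `ℚ`. -/
theorem natDegree_le_of_sum_sq {ι : Type*} [Fintype ι] (q : ι → Polynomial ℚ) {n : ℕ}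
    (h : (∑ i, q i * q i).natDegree ≤ 2 * n) (i : ι) : (q i).natDegree ≤ n := by
  by_contra! hi
  obtain ⟨j, -, hj⟩ := Finset.exists_max_image Finset.univ (fun i => (q i).natDegree)
    ⟨i, Finset.mem_univ i⟩
  have hn : n < (q j).natDegree := hi.trans_le (hj i (Finset.mem_univ i))
  -- At twice the maximal degree, the coefficient is a sum of squares of rationals, so each of them
  -- is zero.
  have h0 : (∑ i, q i * q i).coeff ((q j).natDegree + (q j).natDegree) = 0 :=
    Polynomial.coeff_eq_zero_of_natDegree_lt (by omega)
  rw [Polynomial.finsetSum_coeff, Finset.sum_congr rfl fun k _ =>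
    Polynomial.coeff_mul_add_eq_of_natDegree_le (hj k (Finset.mem_univ k))
      (hj k (Finset.mem_univ k)),
    Finset.sum_eq_zero_iff_of_nonneg fun k _ => mul_self_nonneg _] at h0
  have := mul_self_eq_zero.mp (h0 j (Finset.mem_univ j))
  rw [Polynomial.coeff_natDegree, Polynomial.leadingCoeff_eq_zero] at this
  simp [this] at hn

/-- If a form of degree `2 n` is a sum of squares, then it is a sum of squares of forms. -/
theorem exists_isHomogeneous_of_isSumSq {σ : Type*} {g : MvPolynomial σ ℚ} {n : ℕ}
    (hg : g.IsHomogeneous (2 * n)) (h : IsSumSq g) :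
    ∃ (m : ℕ) (p : Fin m → MvPolynomial σ ℚ),
      (∀ i, (p i).IsHomogeneous n) ∧ g = ∑ i, p i * p i := by
  obtain ⟨m, p, hp⟩ := h.exists_fin_sum
  refine ⟨m, fun i => homogeneousComponent n (p i),
    fun i => homogeneousComponent_isHomogeneous n _, MvPolynomial.funext fun v => ?_⟩
  have hs : restrictLine v g = ∑ i, restrictLine v (p i) * restrictLine v (p i) := by
    simp [hp]
  have hd : (restrictLine v g).natDegree ≤ 2 * n := by
    rw [Polynomial.natDegree_le_iff_coeff_eq_zero]
    intro k hk
    rw [coeff_restrictLine, homogeneousComponent_of_mem hg, if_neg (by omega), map_zero]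
  have hi := natDegree_le_of_sum_sq _ (hs ▸ hd)
  have hc : eval v g = (restrictLine v g).coeff (n + n) := by
    rw [coeff_restrictLine, homogeneousComponent_of_mem hg, if_pos (by omega)]
  rw [hc, hs, Polynomial.finsetSum_coeff]
  simp only [map_sum, map_mul, ← coeff_restrictLine]
  exact Finset.sum_congr rfl fun i _ => Polynomial.coeff_mul_add_eq_of_natDegree_le (hi i) (hi i)

/-- Euler's identity: take the partial derivatives divided by the degree. -/
theorem MvPolynomial.IsHomogeneous.exists_eval_eq_sum {m n : ℕ} {p : MvPolynomial (Fin m) ℚ}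
    (hp : p.IsHomogeneous (n + 1)) :
    ∃ q : Fin m → MvPolynomial (Fin m) ℚ, (∀ i, (q i).IsHomogeneous n) ∧
      ∀ v, eval v p = ∑ i, v i * eval v (q i) := by
  refine ⟨fun i => C ((n + 1 : ℚ)⁻¹) * pderiv i p, fun i => hp.pderiv.C_mul _, fun v => ?_⟩
  have := congrArg (eval v) hp.sum_X_mul_pderiv
  simp only [map_sum, map_mul, eval_X, nsmul_eq_mul, map_natCast] at this
  have hn : (n + 1 : ℚ) ≠ 0 := by positivity
  simp only [map_mul, eval_C, mul_left_comm (v _), ← Finset.mul_sum, this]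
  push_cast
  field_simp

theorem MvPolynomial.IsHomogeneous.exists_eval_eq_cubic {p : MvPolynomial (Fin 4) ℚ}
    (hp : p.IsHomogeneous 3) :
    ∃ c : Fin 4 → Fin 4 → Fin 4 → ℚ, ∀ v,
      eval v p = ∑ i, v i * ∑ j, v j * ∑ k, v k * c i j k := by
  obtain ⟨q, hq, hpq⟩ := hp.exists_eval_eq_sum
  choose r hr hqr using fun i => (hq i).exists_eval_eq_sum
  choose s hs hrs using fun i j => (hr i j).exists_eval_eq_sum
  -- After three applications of Euler's identity the `s i j k` have degree zero, so their value at
  -- 0 is their value everywhere.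
  refine ⟨fun i j k => eval 0 (s i j k), fun v => ?_⟩
  rw [hpq]
  simp only [hqr, hrs]
  refine Finset.sum_congr rfl fun i _ => ?_
  congr 1
  refine Finset.sum_congr rfl fun j _ => ?_
  congr 1
  refine Finset.sum_congr rfl fun k _ => ?_
  have := totalDegree_eq_zero_iff_eq_C.mp ((totalDegree_zero_iff_isHomogeneous _).mpr (hs i j k))
  rw [this]
  simp

theorem MvPolynomial.IsHomogeneous.exists_eval_eq_cubic_coeffs {p : MvPolynomial (Fin 4) ℚ}
    (hp : p.IsHomogeneous 3) :
    ∃ c_xxx c_xxy c_xxz c_xxw c_xyy c_xyz c_xyw c_xzz c_xzw c_xww c_yyy c_yyz c_yyw c_yzz c_yzw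
      c_yww c_zzz c_zzw c_zww c_www : ℚ,
      ∀ x y z w : ℚ, eval ![x, y, z, w] p =
        c_xxx*(x^3) + c_xxy*(x^2*y) + c_xxz*(x^2*z) + c_xxw*(x^2*w) + c_xyy*(x*y^2) +
        c_xyz*(x*y*z) + c_xyw*(x*y*w) + c_xzz*(x*z^2) + c_xzw*(x*z*w) + c_xww*(x*w^2) +
        c_yyy*(y^3) + c_yyz*(y^2*z) + c_yyw*(y^2*w) + c_yzz*(y*z^2) + c_yzw*(y*z*w) +
        c_yww*(y*w^2) + c_zzz*(z^3) + c_zzw*(z^2*w) + c_zww*(z*w^2) + c_www*(w^3) := by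
  obtain ⟨c, hc⟩ := hp.exists_eval_eq_cubic
  refine ⟨c 0 0 0, c 0 0 1 + c 0 1 0 + c 1 0 0, c 0 0 2 + c 0 2 0 + c 2 0 0,
    c 0 0 3 + c 0 3 0 + c 3 0 0, c 0 1 1 + c 1 0 1 + c 1 1 0,
    c 0 1 2 + c 0 2 1 + c 1 0 2 + c 1 2 0 + c 2 0 1 + c 2 1 0,
    c 0 1 3 + c 0 3 1 + c 1 0 3 + c 1 3 0 + c 3 0 1 + c 3 1 0, c 0 2 2 + c 2 0 2 + c 2 2 0,
    c 0 2 3 + c 0 3 2 + c 2 0 3 + c 2 3 0 + c 3 0 2 + c 3 2 0, c 0 3 3 + c 3 0 3 + c 3 3 0,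
    c 1 1 1, c 1 1 2 + c 1 2 1 + c 2 1 1, c 1 1 3 + c 1 3 1 + c 3 1 1,
    c 1 2 2 + c 2 1 2 + c 2 2 1, c 1 2 3 + c 1 3 2 + c 2 1 3 + c 2 3 1 + c 3 1 2 + c 3 2 1,
    c 1 3 3 + c 3 1 3 + c 3 3 1, c 2 2 2, c 2 2 3 + c 2 3 2 + c 3 2 2,
    c 2 3 3 + c 3 2 3 + c 3 3 2, c 3 3 3, fun x y z w => ?_⟩
  rw [hc]
  simp [Fin.sum_univ_four]
  ring

/-! ### The Gram matrix and its inequalities -/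

/-- The cubic forms vanishing on the conics along which the planes `x = 0` and `x + 4 z = 0`
touch the sextic, given by the values of six coordinates. -/
def conicCubic (m n a b c d x y z w : ℚ) : ℚ :=
  m*((x + 4*z)*(w^2 + 21*y*z + 50*z^2))
  + n*(x*(w^2 + 2*y^2 + 21*y*z + 84*z*w + 330*z^2))
  + x*(x + 4*z)*(a*x + b*y + c*z + d*w)

/-- Fourteen rational points of the two curves impose independent conditions on the twenty
coefficients, leaving six parameters. -/
theorem MvPolynomial.IsHomogeneous.exists_eval_eq_conicCubic {p : MvPolynomial (Fin 4) ℚ}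
    (hp : p.IsHomogeneous 3)
    (h0 : ∀ y z w, z*(w^2 + 21*y*z + 50*z^2) = 0 → eval ![0, y, z, w] p = 0)
    (h4 : ∀ y z w, z*(w^2 + 2*y^2 + 21*y*z + 84*z*w + 330*z^2) = 0 →
      eval ![-4*z, y, z, w] p = 0) :
    ∃ m n a b c d : ℚ, ∀ x y z w, eval ![x, y, z, w] p = conicCubic m n a b c d x y z w := by
  obtain ⟨c_xxx, c_xxy, c_xxz, c_xxw, c_xyy, c_xyz, c_xyw, c_xzz, c_xzw, c_xww, c_yyy, c_yyz,
    c_yyw, c_yzz, c_yzw, c_yww, c_zzz, c_zzw, c_zww, c_www, hc⟩ :=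
    hp.exists_eval_eq_cubic_coeffs
  simp only [hc] at h0 h4 ⊢
  -- Four points on the line z = 0, then five on the conic in x = 0, with z = 1 and w = 0, ±1, ±2.
  have e0 := h0 1 0 0 (by norm_num)
  have e1 := h0 0 0 1 (by norm_num)
  have e2 := h0 1 0 1 (by norm_num)
  have e3 := h0 1 0 (-1) (by norm_num)
  have e4 := h0 (-(0 + 50)/21) 1 0 (by norm_num)
  have e5 := h0 (-(1 + 50)/21) 1 1 (by norm_num)
  have e6 := h0 (-(1 + 50)/21) 1 (-1) (by norm_num)
  have e7 := h0 (-(4 + 50)/21) 1 2 (by norm_num)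
  have e8 := h0 (-(4 + 50)/21) 1 (-2) (by norm_num)
  -- Five rational points with z = 1 on the conic in x + 4z = 0.
  have e9 := h4 (-1/2) 1 (-4) (by norm_num)
  have e10 := h4 (-10) 1 (-4) (by norm_num)
  have e11 := h4 (-1/2) 1 (-80) (by norm_num)
  have e12 := h4 (-10) 1 (-80) (by norm_num)
  have e13 := h4 (37/2) 1 (-23) (by norm_num)
  norm_num at e0 e1 e2 e3 e4 e5 e6 e7 e8 e9 e10 e11 e12 e13
  have r_xyz : c_xyz = 21*(c_zww/4) + 21*(c_xyy/2) + 4*c_xxy := by linarith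
  have r_xyw : c_xyw = 0 := by linarith
  have r_xzz : c_xzz = 50*(c_zww/4) + 330*(c_xyy/2) + 4*(c_xxz - 4*c_xxx) := by linarith
  have r_xzw : c_xzw = 84*(c_xyy/2) + 4*c_xxw := by linarith
  have r_xww : c_xww = c_zww/4 + c_xyy/2 := by linarith
  have r_yyy : c_yyy = 0 := by linarith
  have r_yyz : c_yyz = 0 := by linarith
  have r_yyw : c_yyw = 0 := by linarith
  have r_yzz : c_yzz = 21*c_zww := by linarith
  have r_yzw : c_yzw = 0 := by linarith
  have r_yww : c_yww = 0 := by linarith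
  have r_zzz : c_zzz = 50*c_zww := by linarith
  have r_zzw : c_zzw = 0 := by linarith
  have r_www : c_www = 0 := by linarith
  refine ⟨c_zww/4, c_xyy/2, c_xxx, c_xxy, c_xxz - 4*c_xxx, c_xxw, fun x y z w => ?_⟩
  rw [conicCubic, r_xyz, r_xyw, r_xzz, r_xzw, r_xww, r_yyy, r_yyz, r_yyw, r_yzz, r_yzw,
    r_yww, r_zzz, r_zzw, r_www]
  ring

open Matrix in
theorem sum_conicCubic_sq {ι : Type*} [Fintype ι] (m n a b c d : ι → ℚ) (x y z w : ℚ) :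
    ∑ i, conicCubic (m i) (n i) (a i) (b i) (c i) (d i) x y z w *
        conicCubic (m i) (n i) (a i) (b i) (c i) (d i) x y z w =
      (m ⬝ᵥ m)*(((x + 4*z)*(w^2 + 21*y*z + 50*z^2))*((x + 4*z)*(w^2 + 21*y*z + 50*z^2)))
      + 2*(m ⬝ᵥ n)*(((x + 4*z)*(w^2 + 21*y*z + 50*z^2))
        *(x*(w^2 + 2*y^2 + 21*y*z + 84*z*w + 330*z^2)))
      + 2*(m ⬝ᵥ a)*(((x + 4*z)*(w^2 + 21*y*z + 50*z^2))*(x*(x + 4*z)*x))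
      + 2*(m ⬝ᵥ b)*(((x + 4*z)*(w^2 + 21*y*z + 50*z^2))*(x*(x + 4*z)*y))
      + 2*(m ⬝ᵥ c)*(((x + 4*z)*(w^2 + 21*y*z + 50*z^2))*(x*(x + 4*z)*z))
      + 2*(m ⬝ᵥ d)*(((x + 4*z)*(w^2 + 21*y*z + 50*z^2))*(x*(x + 4*z)*w))
      + (n ⬝ᵥ n)*((x*(w^2 + 2*y^2 + 21*y*z + 84*z*w + 330*z^2))^2)
      + 2*(n ⬝ᵥ a)*((x*(w^2 + 2*y^2 + 21*y*z + 84*z*w + 330*z^2))*(x*(x + 4*z)*x))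
      + 2*(n ⬝ᵥ b)*((x*(w^2 + 2*y^2 + 21*y*z + 84*z*w + 330*z^2))*(x*(x + 4*z)*y))
      + 2*(n ⬝ᵥ c)*((x*(w^2 + 2*y^2 + 21*y*z + 84*z*w + 330*z^2))*(x*(x + 4*z)*z))
      + 2*(n ⬝ᵥ d)*((x*(w^2 + 2*y^2 + 21*y*z + 84*z*w + 330*z^2))*(x*(x + 4*z)*w))
      + (a ⬝ᵥ a)*((x*(x + 4*z)*x)*(x*(x + 4*z)*x))
      + 2*(a ⬝ᵥ b)*((x*(x + 4*z)*x)*(x*(x + 4*z)*y))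
      + 2*(a ⬝ᵥ c)*((x*(x + 4*z)*x)*(x*(x + 4*z)*z))
      + 2*(a ⬝ᵥ d)*((x*(x + 4*z)*x)*(x*(x + 4*z)*w))
      + (b ⬝ᵥ b)*((x*(x + 4*z)*y)*(x*(x + 4*z)*y))
      + 2*(b ⬝ᵥ c)*((x*(x + 4*z)*y)*(x*(x + 4*z)*z))
      + 2*(b ⬝ᵥ d)*((x*(x + 4*z)*y)*(x*(x + 4*z)*w))
      + (c ⬝ᵥ c)*((x*(x + 4*z)*z)*(x*(x + 4*z)*z))
      + 2*(c ⬝ᵥ d)*((x*(x + 4*z)*z)*(x*(x + 4*z)*w))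
      + (d ⬝ᵥ d)*((x*(x + 4*z)*w)*(x*(x + 4*z)*w)) := by
  simp only [dotProduct, Finset.mul_sum, Finset.sum_mul, ← Finset.sum_add_distrib]
  refine Finset.sum_congr rfl fun i _ => ?_
  rw [conicCubic]
  ring

/-- The linear relations that comparing coefficients imposes on the Gram matrix. -/
theorem gram_relations (mm mn ma mb mc md nn na nb nc nd aa ab ac ad bb bc bd cc cd dd : ℚ)
    (h : ∀ x y z w : ℚ, sexticExpr x y z w =
      mm*(((x + 4*z)*(w^2 + 21*y*z + 50*z^2))*((x + 4*z)*(w^2 + 21*y*z + 50*z^2)))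
      + 2*mn*(((x + 4*z)*(w^2 + 21*y*z + 50*z^2))
        *(x*(w^2 + 2*y^2 + 21*y*z + 84*z*w + 330*z^2)))
      + 2*ma*(((x + 4*z)*(w^2 + 21*y*z + 50*z^2))*(x*(x + 4*z)*x))
      + 2*mb*(((x + 4*z)*(w^2 + 21*y*z + 50*z^2))*(x*(x + 4*z)*y))
      + 2*mc*(((x + 4*z)*(w^2 + 21*y*z + 50*z^2))*(x*(x + 4*z)*z))
      + 2*md*(((x + 4*z)*(w^2 + 21*y*z + 50*z^2))*(x*(x + 4*z)*w))
      + nn*((x*(w^2 + 2*y^2 + 21*y*z + 84*z*w + 330*z^2))^2)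
      + 2*na*((x*(w^2 + 2*y^2 + 21*y*z + 84*z*w + 330*z^2))*(x*(x + 4*z)*x))
      + 2*nb*((x*(w^2 + 2*y^2 + 21*y*z + 84*z*w + 330*z^2))*(x*(x + 4*z)*y))
      + 2*nc*((x*(w^2 + 2*y^2 + 21*y*z + 84*z*w + 330*z^2))*(x*(x + 4*z)*z))
      + 2*nd*((x*(w^2 + 2*y^2 + 21*y*z + 84*z*w + 330*z^2))*(x*(x + 4*z)*w))
      + aa*((x*(x + 4*z)*x)*(x*(x + 4*z)*x))
      + 2*ab*((x*(x + 4*z)*x)*(x*(x + 4*z)*y))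
      + 2*ac*((x*(x + 4*z)*x)*(x*(x + 4*z)*z))
      + 2*ad*((x*(x + 4*z)*x)*(x*(x + 4*z)*w))
      + bb*((x*(x + 4*z)*y)*(x*(x + 4*z)*y))
      + 2*bc*((x*(x + 4*z)*y)*(x*(x + 4*z)*z))
      + 2*bd*((x*(x + 4*z)*y)*(x*(x + 4*z)*w))
      + cc*((x*(x + 4*z)*z)*(x*(x + 4*z)*z))
      + 2*cd*((x*(x + 4*z)*z)*(x*(x + 4*z)*w))
      + dd*((x*(x + 4*z)*w)*(x*(x + 4*z)*w))) :
    mm = 25/2 ∧ mn = -11/2 ∧ nn = 5/2 ∧ bd = 8 ∧ md = 0 ∧ nd = 0 ∧ cd = 21*bb ∧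
    mc = 560 ∧ nc = -252 - bb ∧ cc = 27244 + 140*bb + 50*dd ∧ aa = 932 ∧
    ma = -103 - dd/2 + bb/4 ∧ na = 47 - bb/4 := by
  simp only [sexticExpr] at h
  have e0 := h 0 0 1 0
  have e1 := h 1 0 0 0
  have e2 := h 1 0 0 1
  have e3 := h 1 0 0 (-1)
  have e4 := h 1 0 1 0
  have e5 := h 1 0 (-1) 0
  have e6 := h 1 1 0 0
  have e7 := h 1 (-1) 0 0
  have e8 := h 1 0 0 2
  have e9 := h 1 0 0 (-2)
  have e10 := h 1 0 1 1
  have e11 := h 1 0 1 (-1)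
  have e12 := h 1 0 (-1) 1
  have e13 := h 1 0 (-1) (-1)
  have e14 := h 1 0 2 0
  have e15 := h 1 1 0 1
  have e16 := h 1 1 0 (-1)
  have e17 := h 1 1 1 0
  have e18 := h 1 1 (-1) 0
  norm_num at e0 e1 e2 e3 e4 e5 e6 e7 e8 e9 e10 e11 e12 e13 e14 e15 e16 e17 e18
  clear h
  refine ⟨?_, ?_, ?_, ?_, ?_, ?_, ?_, ?_, ?_, ?_, ?_, ?_, ?_⟩ <;> linarith

open Matrix in
-- The squared length of a combination of four vectors; suitable coefficients turn it into a Schur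
-- complement.
theorem gram_nonneg {ι : Type*} [Fintype ι] (u₁ u₂ u₃ u₄ : ι → ℚ) (s₁ s₂ s₃ s₄ : ℚ) :
    0 ≤ s₁^2*(u₁ ⬝ᵥ u₁) + s₂^2*(u₂ ⬝ᵥ u₂) + s₃^2*(u₃ ⬝ᵥ u₃) + s₄^2*(u₄ ⬝ᵥ u₄)
      + 2*s₁*s₂*(u₁ ⬝ᵥ u₂) + 2*s₁*s₃*(u₁ ⬝ᵥ u₃) + 2*s₁*s₄*(u₁ ⬝ᵥ u₄)
      + 2*s₂*s₃*(u₂ ⬝ᵥ u₃) + 2*s₂*s₄*(u₂ ⬝ᵥ u₄) + 2*s₃*s₄*(u₃ ⬝ᵥ u₄) := by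
  have h : 0 ≤ ∑ i, (s₁*u₁ i + s₂*u₂ i + s₃*u₃ i + s₄*u₄ i)^2 :=
    Finset.sum_nonneg fun i _ => sq_nonneg _
  convert h using 1
  simp only [dotProduct, Finset.mul_sum, ← Finset.sum_add_distrib]
  refine Finset.sum_congr rfl fun i _ => ?_
  ring

/-- Put u = a² - b and v = 2a - b². The hypotheses give a³ ≥ 2, 0 ≤ v and 10u ≤ v ≤ u(a² + b). As a²
+ b < 10, this forces u = v = 0, so a⁴ = 2a. -/
theorem cube_eq_two_of_inequalities {a b : ℚ} (ha : 0 < a) (hb : 0 < b) (hab : 2 ≤ a*b)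
    (hba : b^2 ≤ 2*a) (h : 10*a^2 + 6*(a*b) + b^2 ≤ 12 + 2*a + 10*b) : a^3 = 2 := by
  have ha3 : 2 ≤ a^3 := by nlinarith [mul_le_mul hab hab (by norm_num) (by positivity)]
  have huv : 10*(a^2 - b) ≤ 2*a - b^2 := by linarith
  have hv : 2*a - b^2 ≤ (a^2 - b)*(a^2 + b) := by nlinarith
  have ha' : a < 9/5 := by nlinarith [sq_nonneg (b - 5)]
  have hb' : b < 2 := by nlinarith
  have hlt : a^2 + b < 10 := by nlinarith
  have hu : a^2 = b := by
    have h1 : 0 ≤ a^2 - b := by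
      by_contra! hc
      nlinarith [mul_pos_of_neg_of_neg hc (neg_neg_of_pos (by positivity : 0 < a^2 + b))]
    nlinarith
  have h4 : a^4 = 2*a := by subst hu; nlinarith
  have : a*(a^3 - 2) = 0 := by linear_combination h4
  rcases mul_eq_zero.mp this with h0 | h0
  · exact absurd h0 ha.ne'
  · linarith

theorem eval_eq_zero_of_sum_mul_self {ι σ : Type*} [Fintype ι] {p : ι → MvPolynomial σ ℚ}
    {g : MvPolynomial σ ℚ} (hg : g = ∑ i, p i * p i) {v : σ → ℚ} (hv : eval v g = 0) (i : ι) :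
    eval v (p i) = 0 := by
  rw [hg, map_sum, Finset.sum_eq_zero_iff_of_nonneg
    (fun i _ => by rw [map_mul]; exact mul_self_nonneg _)] at hv
  simpa using hv i (Finset.mem_univ i)

open Matrix in
theorem not_isSumSq_sexticForm : ¬ IsSumSq sexticForm := by
  intro h
  obtain ⟨k, p, hp, hs⟩ := exists_isHomogeneous_of_isSumSq (n := 3) sexticForm_isHomogeneous h
  have h0 (i) (y z w : ℚ) (hv : z*(w^2 + 21*y*z + 50*z^2) = 0) :
      eval ![0, y, z, w] (p i) = 0 := by
    refine eval_eq_zero_of_sum_mul_self hs ?_ i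
    rw [eval_sexticForm]
    simp only [cons_val, sexticExpr]
    linear_combination (200*z*(w^2 + 21*y*z + 50*z^2)) * hv
  have h4 (i) (y z w : ℚ) (hv : z*(w^2 + 2*y^2 + 21*y*z + 84*z*w + 330*z^2) = 0) :
      eval ![-4*z, y, z, w] (p i) = 0 := by
    refine eval_eq_zero_of_sum_mul_self hs ?_ i
    rw [eval_sexticForm]
    simp only [cons_val, sexticExpr]
    linear_combination (40*z*(w^2 + 2*y^2 + 21*y*z + 84*z*w + 330*z^2)) * hv
  choose m n a b c d hP using fun i => (hp i).exists_eval_eq_conicCubic (h0 i) (h4 i)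
  obtain ⟨hmm, hmn, hnn, hbd, hmd, hnd, hcd, hmc, hnc, hcc, haa, hma, hna⟩ :=
    gram_relations _ _ _ _ _ _ _ _ _ _ _ _ _ _ _ _ _ _ _ _ _ fun x y z w => by
      rw [← sum_conicCubic_sq m n a b c d x y z w]
      simp only [← hP, ← map_mul, ← map_sum, ← hs, eval_sexticForm, cons_val]
  have hcd' : d ⬝ᵥ c = 21*(b ⬝ᵥ b) := by rw [dotProduct_comm, hcd]
  have hBC : 0 ≤ (d ⬝ᵥ d)*((b ⬝ᵥ b)*(d ⬝ᵥ d) - 64) := by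
    -- D times the component of `b` orthogonal to `d`.
    have := gram_nonneg b d 0 0 (d ⬝ᵥ d) (-8) 0 0
    simp only [hbd, dotProduct_zero] at this
    linarith
  have hD0 : 0 ≤ d ⬝ᵥ d := by simpa using gram_nonneg d 0 0 0 1 0 0 0
  have hB0 : 0 ≤ b ⬝ᵥ b := by simpa using gram_nonneg b 0 0 0 1 0 0 0
  have hD : 0 < d ⬝ᵥ d := by
    refine hD0.lt_of_ne' fun h => ?_
    rw [dotProduct_self_eq_zero] at h
    simp [h] at hbd
  have hBD : 64 ≤ (b ⬝ᵥ b)*(d ⬝ᵥ d) := by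
    have := nonneg_of_mul_nonneg_right hBC hD
    linarith
  have hB : 0 < b ⬝ᵥ b := hB0.lt_of_ne' fun h => by norm_num [h] at hBD
  -- D times the component of `c` orthogonal to `m`, `n`, `d`. The Gram matrix of `m`, `n` has
  -- determinant 1, so its inverse has entries 5/2, 11/2, 25/2.
  have h2 := gram_nonneg m n c d (-(d ⬝ᵥ d)*(14 - 11/2*(b ⬝ᵥ b)))
    (-(d ⬝ᵥ d)*(-70 - 25/2*(b ⬝ᵥ b))) (d ⬝ᵥ d) (-21*(b ⬝ᵥ b))
  -- The component of `a` orthogonal to `m`, `n`.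
  have h3 := gram_nonneg m n a 0 (-(5/2*(m ⬝ᵥ a) + 11/2*(n ⬝ᵥ a)))
    (-(11/2*(m ⬝ᵥ a) + 25/2*(n ⬝ᵥ a))) 1 0
  simp only [hmm, hmn, hnn, hmd, hnd, hcd, hmc, hnc, hcc, haa, hma, hna, dotProduct_zero]
    at h2 h3
  generalize b ⬝ᵥ b = B at *
  generalize d ⬝ᵥ d = D at *
  have hBD2 : B^2 ≤ 4*D := by
    have : 0 ≤ (D*(441 + 25/2*D))*(4*D - B^2) := by linarith
    have := nonneg_of_mul_nonneg_right this (by positivity)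
    linarith
  -- In the decomposition over ℚ(t), D = 8t and B = 4t², so `a`, `b` play the roles of t, t².
  exact cube_ne_two _ (cube_eq_two_of_inequalities (a := D/8) (b := B/4) (by positivity)
    (by positivity) (by linarith) (by linarith) (by linarith))

/-! ### Irreducibility over ℂ: the grading by degree in y, w -/

/-- The substitution scaling the second and the fourth variable by a new variable. -/
noncomputable def scaleYW : MvPolynomial (Fin 4) ℂ →ₐ[ℂ] Polynomial (MvPolynomial (Fin 4) ℂ) :=
  aeval ![Polynomial.C (X 0), Polynomial.C (X 1) * Polynomial.X, Polynomial.C (X 2),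
    Polynomial.C (X 3) * Polynomial.X]

theorem scaleYW_C (a : ℂ) : scaleYW (C a) = Polynomial.C (C a) := by
  rw [← algebraMap_eq, AlgHom.commutes]; rfl

theorem scaleYW_X0 : scaleYW (X 0) = Polynomial.C (X 0) := by simp [scaleYW]
theorem scaleYW_X1 : scaleYW (X 1) = Polynomial.C (X 1) * Polynomial.X := by simp [scaleYW]
theorem scaleYW_X2 : scaleYW (X 2) = Polynomial.C (X 2) := by simp [scaleYW]
theorem scaleYW_X3 : scaleYW (X 3) = Polynomial.C (X 3) * Polynomial.X := by simp [scaleYW]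

theorem scaleYW_monomial (d : Fin 4 →₀ ℕ) (a : ℂ) :
    scaleYW (monomial d a) = Polynomial.C (monomial d a) * Polynomial.X ^ (d 1 + d 3) := by
  rw [monomial_eq, Finsupp.prod_fintype _ _ (by simp)]
  simp only [Fin.prod_univ_four, map_mul, map_pow, scaleYW_C, scaleYW_X0, scaleYW_X1, scaleYW_X2,
    scaleYW_X3]
  ring

/-- The coefficients of `scaleYW g` are the components of `g` for the degree in `y, w`. -/
theorem scaleYW_coeff (g : MvPolynomial (Fin 4) ℂ) (k : ℕ) :
    scaleYW ((scaleYW g).coeff k) = Polynomial.C ((scaleYW g).coeff k) * Polynomial.X ^ k := by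
  induction g using MvPolynomial.induction_on' with
  | monomial d a =>
    simp only [scaleYW_monomial, Polynomial.coeff_C_mul, Polynomial.coeff_X_pow]
    split_ifs with h
    · simp [scaleYW_monomial, h]
    · simp
  | add p q hp hq => simp [hp, hq, add_mul]

theorem eval_one_scaleYW (g : MvPolynomial (Fin 4) ℂ) : (scaleYW g).eval 1 = g := by
  have : ((Polynomial.aeval (1 : MvPolynomial (Fin 4) ℂ)).restrictScalars ℂ).comp scaleYW =
      AlgHom.id ℂ _ := by
    ext i
    fin_cases i <;> simp [scaleYW]
  simpa [Polynomial.aeval_def, Polynomial.eval₂_eq_eval_map] using DFunLike.congr_fun this g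

theorem eval_eval_zero_scaleYW (g : MvPolynomial (Fin 4) ℂ) (a b c d : ℂ) :
    eval ![a, b, c, d] ((scaleYW g).eval 0) = eval ![a, 0, c, 0] g := by
  have : ((aeval ![a, b, c, d]).comp
      ((Polynomial.aeval (0 : MvPolynomial (Fin 4) ℂ)).restrictScalars ℂ)).comp scaleYW =
      aeval ![a, 0, c, 0] := by
    ext i
    fin_cases i <;> simp [scaleYW]
  simpa [Polynomial.aeval_def, Polynomial.eval₂_eq_eval_map, aeval_eq_eval] using
    DFunLike.congr_fun this g

theorem eval_eq_of_scaleYW_eq_C {g : MvPolynomial (Fin 4) ℂ} (hg : scaleYW g = Polynomial.C g)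
    (a b c d : ℂ) : eval ![a, b, c, d] g = eval ![a, 0, c, 0] g := by
  rw [← eval_eval_zero_scaleYW g a b c d, hg, Polynomial.eval_C]

theorem eq_of_scaleYW {u : MvPolynomial (Fin 4) ℂ} {k m : ℕ} (hu : u ≠ 0)
    (hk : scaleYW u = Polynomial.C u * Polynomial.X ^ k)
    (hm : scaleYW u = Polynomial.C u * Polynomial.X ^ m) : k = m := by
  by_contra hne
  have := congrArg (Polynomial.coeff · k) (hk.symm.trans hm)
  simp [Polynomial.coeff_X_pow, hne] at this
  exact hu this

theorem scaleYW_leadingCoeff (g : MvPolynomial (Fin 4) ℂ) :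
    scaleYW (scaleYW g).leadingCoeff =
      Polynomial.C (scaleYW g).leadingCoeff * Polynomial.X ^ (scaleYW g).natDegree :=
  scaleYW_coeff g _

theorem exists_eq_C_of_isUnit {g : MvPolynomial (Fin 4) ℂ} (hg : IsUnit g) :
    ∃ c : ℂ, c ≠ 0 ∧ g = C c := by
  obtain ⟨c, hc, rfl⟩ := MvPolynomial.isUnit_iff_eq_C_of_isReduced.mp hg
  exact ⟨c, hc.ne_zero, rfl⟩

/-- The leading part is homogeneous in y, w of degree `natDegree`; a nonzero constant has degree
zero, so `g` equals its leading part. -/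
theorem isUnit_of_isUnit_leadingCoeff {g : MvPolynomial (Fin 4) ℂ}
    (hg : IsUnit (scaleYW g).leadingCoeff) : IsUnit g := by
  have hlc := scaleYW_leadingCoeff g
  have h0 : (scaleYW g).natDegree = 0 := by
    refine eq_of_scaleYW hg.ne_zero hlc ?_
    obtain ⟨c, -, hc⟩ := exists_eq_C_of_isUnit hg
    rw [hc, scaleYW_C, pow_zero, mul_one]
  have h1 := eval_one_scaleYW g
  rw [Polynomial.eq_C_of_natDegree_eq_zero h0, Polynomial.eval_C] at h1
  rw [← h1]
  simpa [Polynomial.leadingCoeff, h0] using hg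

theorem notMem_vars_of_mem_supported {σ R : Type*} [CommRing R] {p : MvPolynomial σ R} {i : σ}
    (hp : p ∈ supported R ({i}ᶜ : Set σ)) : i ∉ p.vars :=
  fun hi => mem_supported.mp hp hi rfl

/-- Linear in z with relatively prime coefficients, since w does not divide the constant term. -/
theorem irreducible_mul_sq_mul_add {a b c : ℂ} (ha : a ≠ 0) (hc : c ≠ 0) :
    Irreducible (C a * X 3 ^ 2 * X 2 + X 0 * (C b * X 3 ^ 2 + C c * X 1 ^ 2) :
      MvPolynomial (Fin 4) ℂ) := by
  have hC (r : ℂ) : C r ∈ supported ℂ ({2}ᶜ : Set (Fin 4)) := Subalgebra.algebraMap_mem _ r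
  have hX (i : Fin 4) (hi : i ≠ 2) : X i ∈ supported ℂ ({2}ᶜ : Set (Fin 4)) :=
    X_mem_supported.mpr hi
  refine irreducible_mul_X_add _ _ 2 (by simp [ha]) (notMem_vars_of_mem_supported ?_)
    (notMem_vars_of_mem_supported ?_) ?_
  · exact mul_mem (hC a) (pow_mem (hX 3 (by decide)) 2)
  · exact mul_mem (hX 0 (by decide)) (add_mem
      (mul_mem (hC b) (pow_mem (hX 3 (by decide)) 2))
      (mul_mem (hC c) (pow_mem (hX 1 (by decide)) 2)))
  · rw [isRelPrime_mul_unit_left_left (ha.isUnit.map C)]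
    refine IsRelPrime.pow_left ((X_prime.irreducible.isRelPrime_iff_not_dvd).mpr ?_)
    rintro ⟨q, hq⟩
    have := congrArg (eval ![1, 1, 0, 0]) hq
    simp [hc] at this

/-- The part of degree two in `y, w` of a complex linear combination of the two first cubics. -/
noncomputable def topPart (s : ℂ) : MvPolynomial (Fin 4) ℂ :=
  C (14 + 2*s) * X 3 ^ 2 * X 2 + X 0 * (C 2 * X 3 ^ 2 + C (-3 - s) * X 1 ^ 2)

/-- The part of degree one in `y, w` of the same combination. -/
noncomputable def linPart (s : ℂ) : MvPolynomial (Fin 4) ℂ :=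
  C (-126 - 42*s) * (X 0 * X 2 * X 3) + C 42 * (X 0 * X 1 * X 2) + C (294 + 42*s) * (X 1 * X 2 ^ 2)

/-- The part of degree zero in `y, w` of the same combination. -/
noncomputable def constPart (s t : ℂ) : MvPolynomial (Fin 4) ℂ :=
  C (296 - 8*t^2 + s*(28 + 56*t^2)) * (X 0 * X 2 ^ 2)
  + C (42 - 8*t - 2*t^2 + s*(2 + 24*t + 22*t^2)) * (X 0 ^ 2 * X 2)
  + C (-28 - 2*t + s*(2*t^2 + 6*t - 10)) * X 0 ^ 3 + C (700 + 100*s) * X 2 ^ 3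

theorem map_sexticForm_eq_mul_add_sq {s t : ℂ} (hs : s^2 = -1) (ht : t^3 = 2) :
    MvPolynomial.map (algebraMap ℚ ℂ) sexticForm =
      (topPart s + linPart s + constPart s t) * (topPart (-s) + linPart (-s) + constPart (-s) t)
        + cubicTrd (C t) (X 0) (X 1) (X 2) (X 3) ^ 2 := by
  have key (s : ℂ) : topPart s + linPart s + constPart s t =
      cubicFst (C t) (X 0) (X 1) (X 2) (X 3) + C s * cubicSnd (C t) (X 0) (X 1) (X 2) (X 3) := by
    simp only [topPart, linPart, constPart, cubicFst, cubicSnd, map_add, map_sub, map_mul,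
      map_pow, map_neg, map_ofNat]
    ring
  have hs' : (C s : MvPolynomial (Fin 4) ℂ) ^ 2 = -1 := by rw [← map_pow, hs, map_neg, map_one]
  rw [map_sexticForm, sexticExpr_eq_sum_sq (t := C t) (by rw [← map_pow, ht, map_ofNat]),
    key, key, map_neg]
  linear_combination (cubicSnd (C t) (X 0) (X 1) (X 2) (X 3)) ^ 2 * hs'

theorem scaleYW_topPart (s : ℂ) :
    scaleYW (topPart s) = Polynomial.C (topPart s) * Polynomial.X ^ 2 := by
  simp only [topPart, map_add, map_mul, map_pow, scaleYW_C, scaleYW_X0, scaleYW_X1, scaleYW_X2,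
    scaleYW_X3]
  ring

theorem scaleYW_linPart (s : ℂ) :
    scaleYW (linPart s) = Polynomial.C (linPart s) * Polynomial.X := by
  simp only [linPart, map_add, map_mul, map_pow, scaleYW_C, scaleYW_X0, scaleYW_X1, scaleYW_X2,
    scaleYW_X3]
  ring

theorem scaleYW_constPart (s t : ℂ) :
    scaleYW (constPart s t) = Polynomial.C (constPart s t) := by
  simp only [constPart, map_add, map_mul, map_pow, scaleYW_C, scaleYW_X0, scaleYW_X2]

theorem scaleYW_cubicTrd (t : ℂ) :
    scaleYW (cubicTrd (C t) (X 0) (X 1) (X 2) (X 3)) =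
      Polynomial.C (2 * X 0 * (X 0 + 4 * X 2) * (C t ^ 2 * X 3 + C t * X 1)) * Polynomial.X
        + Polynomial.C (42 * X 0 * (X 0 + 4 * X 2) * X 2) := by
  simp only [cubicTrd, map_add, map_mul, map_pow, map_ofNat, scaleYW_C, scaleYW_X0, scaleYW_X1,
    scaleYW_X2, scaleYW_X3]
  ring

theorem irreducible_topPart {s : ℂ} (hs : s^2 = -1) : Irreducible (topPart s) := by
  refine irreducible_mul_sq_mul_add (fun h => ?_) (fun h => ?_)
  · have : (200 : ℂ) = 0 := by linear_combination (14 - 2*s) * h + 4 * hs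
    norm_num at this
  · have : (10 : ℂ) = 0 := by linear_combination (-3 + s) * h + hs
    norm_num at this

theorem not_topPart_dvd_topPart_neg {s : ℂ} (hs : s^2 = -1) : ¬ topPart s ∣ topPart (-s) := by
  rintro ⟨q, hq⟩
  -- At x = w = 1, y = 0, the zero in z is -1/(7 + s) = -(7 - s)/50.
  have h1 : eval ![1, 0, -(7 - s)/50, 1] (topPart s) = 0 := by
    simp only [topPart, map_add, map_mul, map_pow, eval_C, eval_X, Matrix.cons_val]
    linear_combination (1/25) * hs
  have h2 : eval ![1, 0, -(7 - s)/50, 1] (topPart (-s)) = 0 := by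
    rw [hq, map_mul, h1, zero_mul]
  simp only [topPart, map_add, map_mul, map_pow, eval_C, eval_X, Matrix.cons_val] at h2
  have : (50 : ℂ) = 0 := by linear_combination (25*(1 - 7*s)/2)*h2 + (49 + (1 - 7*s)/2)*hs
  norm_num at this

theorem scaleYW_map_sexticForm {s t : ℂ} (hs : s^2 = -1) (ht : t^3 = 2) :
    scaleYW (MvPolynomial.map (algebraMap ℚ ℂ) sexticForm) =
      (Polynomial.C (topPart s) * Polynomial.X ^ 2 + Polynomial.C (linPart s) * Polynomial.X
          + Polynomial.C (constPart s t))
        * (Polynomial.C (topPart (-s)) * Polynomial.X ^ 2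
          + Polynomial.C (linPart (-s)) * Polynomial.X + Polynomial.C (constPart (-s) t))
        + (Polynomial.C (2 * X 0 * (X 0 + 4 * X 2) * (C t ^ 2 * X 3 + C t * X 1)) * Polynomial.X
          + Polynomial.C (42 * X 0 * (X 0 + 4 * X 2) * X 2)) ^ 2 := by
  simp only [map_sexticForm_eq_mul_add_sq hs ht, map_add, map_mul, map_pow, scaleYW_topPart,
    scaleYW_linPart, scaleYW_constPart]
  rw [scaleYW_cubicTrd]
  simp only [map_add, map_mul, map_pow]

/-- The sextic is not a product of two factors whose leading parts are the two conjugate factors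
of the leading part of the sextic. -/
theorem map_sexticForm_ne_mul_of_leadingCoeff {s t : ℂ} (hs : s^2 = -1) (ht : t^3 = 2)
    {g h : MvPolynomial (Fin 4) ℂ} (hg : (scaleYW g).leadingCoeff = topPart s)
    (hh : (scaleYW h).leadingCoeff = topPart (-s)) :
    MvPolynomial.map (algebraMap ℚ ℂ) sexticForm ≠ g * h := by
  intro hf
  have hs' : (-s)^2 = -1 := by rw [neg_sq, hs]
  have htop := irreducible_topPart hs
  have hdeg {u : MvPolynomial (Fin 4) ℂ} {r : ℂ} (hr : r^2 = -1)
      (hu : (scaleYW u).leadingCoeff = topPart r) : scaleYW u =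
        Polynomial.C (topPart r) * Polynomial.X ^ 2
          + Polynomial.C ((scaleYW u).coeff 1) * Polynomial.X
          + Polynomial.C ((scaleYW u).coeff 0) := by
    have h2 : (scaleYW u).natDegree = 2 :=
      eq_of_scaleYW (irreducible_topPart hr).ne_zero (hu ▸ scaleYW_leadingCoeff u)
        (scaleYW_topPart r)
    rw [Polynomial.leadingCoeff, h2] at hu
    rw [← hu]
    exact Polynomial.eq_quadratic_of_degree_le_two
      (Polynomial.natDegree_le_iff_degree_le.mp h2.le)
  have heq := scaleYW_map_sexticForm hs ht
  -- The zero square puts both sides in the shape of the quartic coefficient lemmas.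
  have hmul : scaleYW g * scaleYW h = scaleYW g * scaleYW h + (Polynomial.C 0 * Polynomial.X
      + Polynomial.C 0) ^ 2 := by simp
  rw [hf, map_mul, hmul, hdeg hs hg, hdeg hs' hh] at heq
  have e3 := congrArg (Polynomial.coeff · 3) heq
  have e2 := congrArg (Polynomial.coeff · 2) heq
  simp only [coeff_quadratic_mul_add_sq_three, coeff_quadratic_mul_add_sq_two] at e3 e2
  have hg1 := scaleYW_coeff g 1
  have hg0 := scaleYW_coeff g 0
  have hh0 := scaleYW_coeff h 0
  rw [pow_zero, mul_one] at hg0 hh0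
  rw [pow_one] at hg1
  generalize (scaleYW g).coeff 1 = g₁ at *
  generalize (scaleYW g).coeff 0 = g₀ at *
  generalize (scaleYW h).coeff 1 = h₁ at *
  generalize (scaleYW h).coeff 0 = h₀ at *
  have hdvd : topPart s ∣ (g₁ - linPart s) * topPart (-s) :=
    ⟨linPart (-s) - h₁, by linear_combination e3⟩
  obtain ⟨q, hq⟩ := (htop.prime.dvd_or_dvd hdvd).resolve_right (not_topPart_dvd_topPart_neg hs)
  -- A multiple of `topPart s` has no component of degree one in y, w.
  have hlin : g₁ = linPart s := by
    have h1 : scaleYW (g₁ - linPart s) = Polynomial.C (g₁ - linPart s) * Polynomial.X := by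
      rw [map_sub, hg1, scaleYW_linPart, map_sub, sub_mul]
    have h2 := congrArg (Polynomial.coeff · 1) h1
    rw [hq, map_mul, scaleYW_topPart, ← hq, mul_assoc, mul_comm (Polynomial.X ^ 2)] at h2
    simp only [Polynomial.coeff_C_mul, Polynomial.coeff_mul_X_pow', Polynomial.coeff_X_one] at h2
    norm_num at h2
    exact sub_eq_zero.mp h2.symm
  have hlin' : h₁ = linPart (-s) := by
    rw [hlin] at e3
    exact mul_left_cancel₀ htop.ne_zero (add_right_cancel e3)
  have e : topPart s * (h₀ - constPart (-s) t) + topPart (-s) * (g₀ - constPart s t) =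
      (2 * X 0 * (X 0 + 4 * X 2) * (C t ^ 2 * X 3 + C t * X 1)) ^ 2 := by
    rw [hlin, hlin'] at e2
    linear_combination e2
  -- At z = 0 the left side is even in w, since the degree-zero parts involve only x and z. The
  -- right side changes by 16t³ = 32 between w = 1 and w = -1.
  have e₁ := congrArg (eval ![1, 1, 0, 1]) e
  have e₂ := congrArg (eval ![1, 1, 0, -1]) e
  simp only [map_add, map_sub, map_mul, map_pow, map_ofNat, eval_C, eval_X, topPart,
    eval_eq_of_scaleYW_eq_C hg0 1 1 0, eval_eq_of_scaleYW_eq_C hh0 1 1 0,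
    eval_eq_of_scaleYW_eq_C (scaleYW_constPart s t) 1 1 0,
    eval_eq_of_scaleYW_eq_C (scaleYW_constPart (-s) t) 1 1 0, Matrix.cons_val] at e₁ e₂
  have : (32 : ℂ) = 0 := by linear_combination e₂ - e₁ - 16*ht
  norm_num at this

theorem irreducible_map_sexticForm :
    Irreducible (MvPolynomial.map (algebraMap ℚ ℂ) sexticForm) := by
  obtain ⟨t, ht⟩ := IsAlgClosed.exists_pow_nat_eq (2 : ℂ) (n := 3) (by norm_num)
  have hs : Complex.I ^ 2 = -1 := Complex.I_sq
  have hs' : (-Complex.I) ^ 2 = -1 := by rw [neg_sq, hs]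
  have hp := (irreducible_topPart hs).prime
  have hp' := irreducible_topPart hs'
  refine ⟨fun hu => ?_, fun g h hgh => ?_⟩
  · have := hu.map (eval (0 : Fin 4 → ℂ))
    rw [map_sexticForm] at this
    simp [sexticExpr] at this
  have hlc : (scaleYW g).leadingCoeff * (scaleYW h).leadingCoeff =
      topPart Complex.I * topPart (-Complex.I) := by
    rw [← Polynomial.leadingCoeff_mul, ← map_mul, ← hgh, scaleYW_map_sexticForm hs ht,
      leadingCoeff_quadratic_mul_add_sq _ _ _ _ _ _ _ _ (mul_ne_zero hp.ne_zero hp'.ne_zero)]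
  wlog hdvd : topPart Complex.I ∣ (scaleYW g).leadingCoeff generalizing g h
  · exact (this h g (by rw [hgh, mul_comm]) (by rw [mul_comm, hlc])
      ((hp.dvd_or_dvd (hlc ▸ dvd_mul_right _ _)).resolve_left hdvd)).symm
  obtain ⟨q, hq⟩ := hdvd
  have hqh : topPart (-Complex.I) = q * (scaleYW h).leadingCoeff := by
    refine mul_left_cancel₀ hp.ne_zero ?_
    rw [← hlc, hq, mul_assoc]
  rcases hp'.isUnit_or_isUnit hqh with hu | hu
  · obtain ⟨c, hc, rfl⟩ := exists_eq_C_of_isUnit hu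
    have hcc : (C c * C c⁻¹ : MvPolynomial (Fin 4) ℂ) = 1 := by
      rw [← C_mul, mul_inv_cancel₀ hc, C_1]
    -- Rescaling by `c` makes the leading parts equal to the conjugate factors, not merely
    -- associated to them.
    refine absurd ?_ (map_sexticForm_ne_mul_of_leadingCoeff hs ht (g := C c⁻¹ * g) (h := C c * h)
      ?_ ?_)
    · linear_combination hgh - g * h * hcc
    · rw [map_mul, scaleYW_C, Polynomial.leadingCoeff_mul, Polynomial.leadingCoeff_C, hq]
      linear_combination topPart Complex.I * hcc
    · rw [map_mul, scaleYW_C, Polynomial.leadingCoeff_mul, Polynomial.leadingCoeff_C, hqh]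
  · exact Or.inr (isUnit_of_isUnit_leadingCoeff hu)

/-! ### The main theorem and the two questions -/

theorem isSumSq_map_sexticForm {R : Type*} [CommRing R] [Algebra ℚ R] {t : R} (ht : t^3 = 2) :
    IsSumSq (MvPolynomial.map (algebraMap ℚ R) sexticForm) := by
  obtain ⟨p, hp⟩ := map_sexticForm_eq_sum_sq ht
  rw [hp]
  exact IsSumSq.sum_sq _ _

theorem gen_adjoin_cube_eq_two {α : ℂ} (h : α ^ 3 = 2) :
    (IntermediateField.AdjoinSimple.gen ℚ α) ^ 3 = 2 := by
  refine Subtype.ext ?_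
  rw [SubmonoidClass.coe_pow, IntermediateField.AdjoinSimple.coe_gen, h]
  rfl

theorem mainTheorem2 :
    -- `f` is a sextic form
    sexticForm.IsHomogeneous 6 ∧
    -- for every root `α` of `Z ^ 3 - 2`, the field `ℚ(α)` has degree three over `ℚ`,
    -- and `f` is a sum of three squares in `ℚ(α)[x, y, z, w]`
    (∀ α : ℂ, α ^ 3 = 2 →
      Module.finrank ℚ (IntermediateField.adjoin ℚ {α}) = 3 ∧
      ∃ p : Fin 3 → MvPolynomial (Fin 4) (IntermediateField.adjoin ℚ {α}),
        MvPolynomial.map (algebraMap ℚ (IntermediateField.adjoin ℚ {α})) sexticForm =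
          ∑ i, p i ^ 2) ∧
    -- `f` is not a sum of squares in `ℚ[x, y, z, w]`
    ¬ IsSumSq sexticForm ∧
    -- `f` is irreducible over `ℂ`
    Irreducible (MvPolynomial.map (algebraMap ℚ ℂ) sexticForm) ∧
    -- it is not true that every rational form that is a sum of squares over a number field
    -- of odd degree is a sum of squares over `ℚ`
    (¬ ∀ (K : Type) [Field K] [NumberField K], Odd (Module.finrank ℚ K) →
      ∀ (n d : ℕ) (g : MvPolynomial (Fin n) ℚ), g.IsHomogeneous d →
        IsSumSq (MvPolynomial.map (algebraMap ℚ K) g) → IsSumSq g) ∧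
    -- there are rational forms that are sums of squares over `ℝ` but not over `ℚ`
    -- and that are irreducible over `ℂ`
    (∃ (n d : ℕ) (g : MvPolynomial (Fin n) ℚ), g.IsHomogeneous d ∧
      IsSumSq (MvPolynomial.map (algebraMap ℚ ℝ) g) ∧ ¬ IsSumSq g ∧
      Irreducible (MvPolynomial.map (algebraMap ℚ ℂ) g)) := by
  refine ⟨sexticForm_isHomogeneous, fun α hα => ⟨finrank_adjoin_of_cube_eq_two hα,
    map_sexticForm_eq_sum_sq (gen_adjoin_cube_eq_two hα)⟩, not_isSumSq_sexticForm,
    irreducible_map_sexticForm, fun h => ?_, 4, 6, sexticForm, sexticForm_isHomogeneous, ?_,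
    not_isSumSq_sexticForm, irreducible_map_sexticForm⟩
  · obtain ⟨α, hα⟩ := IsAlgClosed.exists_pow_nat_eq (2 : ℂ) (n := 3) (by norm_num)
    have hd := finrank_adjoin_of_cube_eq_two hα
    have : FiniteDimensional ℚ (IntermediateField.adjoin ℚ {α}) :=
      Module.finite_of_finrank_pos (by omega)
    have : NumberField (IntermediateField.adjoin ℚ {α}) := ⟨⟩
    exact not_isSumSq_sexticForm (h (IntermediateField.adjoin ℚ {α}) (by rw [hd]; decide) 4 6
      sexticForm sexticForm_isHomogeneous (isSumSq_map_sexticForm (gen_adjoin_cube_eq_two hα)))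
  · refine isSumSq_map_sexticForm (t := (2 : ℝ) ^ (1 / 3 : ℝ)) ?_
    rw [← Real.rpow_natCast, ← Real.rpow_mul (by norm_num)]
    norm_num
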